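/- For a (simple, undirected) graph $G$ and a natural number $k$, a packing $k$-coloring of $G$ is a partition of the vertex set into (possibly empty) classes $X_1,\dots,X_k$ such that for every $i\in\{1,\dots,k\}$ any two distinct vertices of $X_i$ are at distance greater than $i$ in $G$. The packing chromatic number $\chi_\rho(G)$ is the smallest $k$ for which $G$ has a packing $k$-coloring ($\infty$ if there is none). For positive integers $a,b$ let $D(a,b)$ be the infinite graph with vertex set $\mathbb{Z}$ in which two distinct integers $i,j$ are adjacent if and only if $|i-j|\in\{a,b\}$. Then $$\chi_\rho(D(1,6))\ge 15\qquad\text{and}\qquad \chi_\rho(D(1,8))\ge 15 .$$ -/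

import Mathlib

namespace PackingColoring

/-- A set `X` of vertices of `G` is an `i`-packing if any two distinct vertices of `X` are at
distance greater than `i` (vertices in different components are at distance `⊤`). -/
def IsPacking {V : Type*} (G : SimpleGraph V) (i : ℕ) (X : Set V) : Prop :=
  ∀ u ∈ X, ∀ v ∈ X, u ≠ v → (i : ℕ∞) < G.edist u v

/-- `c` is a packing `k`-coloring of `G`: every color lies in `{1, …, k}`, and for every such
color `i` the class of color `i` (possibly empty) is an `i`-packing. -/
def IsPackingColoring {V : Type*} (G : SimpleGraph V) (k : ℕ) (c : V → ℕ) : Prop :=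
  (∀ v, c v ∈ Finset.Icc 1 k) ∧ ∀ i ∈ Finset.Icc 1 k, IsPacking G i {v | c v = i}

/-- `G` has a packing `k`-coloring. -/
def PackingColorable {V : Type*} (G : SimpleGraph V) (k : ℕ) : Prop :=
  ∃ c : V → ℕ, IsPackingColoring G k c

/-- The packing chromatic number: the smallest `k` for which `G` has a packing `k`-coloring
(`⊤` if there is no such `k`), in the style of `SimpleGraph.chromaticNumber`. -/
noncomputable def packingChromaticNumber {V : Type*} (G : SimpleGraph V) : ℕ∞ :=
  ⨅ k ∈ {k : ℕ | PackingColorable G k}, (k : ℕ∞)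

/-- The distance graph on the integers with distance set `D`: distinct integers `i`, `j` are
adjacent if and only if `|i - j| ∈ D`. -/
def distanceGraph (D : Set ℕ) : SimpleGraph ℤ where
  Adj i j := i ≠ j ∧ (i - j).natAbs ∈ D
  symm := ⟨fun i j h => ⟨h.1.symm, by rw [← Int.natAbs_neg, neg_sub]; exact h.2⟩⟩
  loopless := ⟨fun _ h => h.1 rfl⟩

end PackingColoring

namespace PackingColoring

open Finset

/-! The argument is by density. In a packing coloring with at most 14 colors the classes cover `ℤ`,
so upper bounds on their densities must sum to at least 1; here the bounds sum to about 0.999 for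
both graphs. Colors 1 and 2 are bounded jointly, because the bound for a union can be smaller than
the sum of separate bounds. Each bound comes from a finite search (`check`): from every starting
point some short window has density at most `p / q` (`exists_window_of_check`). Concatenating
windows makes this global (`mul_count_le`). -/

/-- A sufficient arithmetic condition for two integers at difference `d` to be at distance at most
`i` in `distanceGraph {1, t}`. -/
def near (t i d : ℕ) : Bool :=
  Nat.ble (d / t + d % t) i || Nat.ble (d / t + 1 + (t - d % t)) i

/-- The color `k` can be prepended to the word `w`, whose letters sit at differences
`d, d + 1, …` from the new one, without two occurrences of `k` being near. -/
def admissible (t k : ℕ) : ℕ → List ℕ → Bool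
  | _, [] => true
  | d, a :: w => (!Nat.beq a k || !near t k d) && admissible t k (d + 1) w

/-- Exhaustive search with at most `fuel` further letters: every extension of the word `w` (latest
letter first, of length `len` and with `cnt` nonzero letters) by colors in `K` or the blank letter
`0` acquires a prefix in which the proportion of nonzero letters is at most `p / q`. -/
def check (t : ℕ) (K : List ℕ) (p q : ℕ) : ℕ → ℕ → ℕ → List ℕ → Bool
  | 0, _, _, _ => false
  | fuel + 1, len, cnt, w =>
    (Nat.ble (q * cnt) (p * (len + 1)) || check t K p q fuel (len + 1) cnt (0 :: w)) &&
    K.all fun k => !admissible t k 1 w ||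
      (Nat.ble (q * (cnt + 1)) (p * (len + 1)) ||
        check t K p q fuel (len + 1) (cnt + 1) (k :: w))

theorem edist_add_mul_le {D : Set ℕ} {m : ℕ} (hm : m ∈ D) (hm0 : m ≠ 0) (x : ℤ) (n : ℕ) :
    (distanceGraph D).edist x (x + n * m) ≤ n := by
  induction n with
  | zero => simp
  | succ n ih =>
    have hadj : (distanceGraph D).Adj (x + n * m) (x + (n + 1 : ℕ) * m) := by
      refine ⟨?_, ?_⟩
      · intro h
        push_cast at h
        have : (m : ℤ) = 0 := by linarith
        exact hm0 (by exact_mod_cast this)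
      · have : x + n * m - (x + (n + 1 : ℕ) * m) = -(m : ℤ) := by push_cast; ring
        rw [this, Int.natAbs_neg, Int.natAbs_natCast]
        exact hm
    calc (distanceGraph D).edist x (x + (n + 1 : ℕ) * m)
        ≤ (distanceGraph D).edist x (x + n * m) +
          (distanceGraph D).edist (x + n * m) (x + (n + 1 : ℕ) * m) :=
          SimpleGraph.edist_triangle
      _ ≤ n + 1 := add_le_add ih (SimpleGraph.edist_eq_one_iff_adj.2 hadj).le
      _ = ((n + 1 : ℕ) : ℕ∞) := by push_cast; rfl

/-- Take `d / t` long steps and finish with unit steps forward, or overshoot by one more long step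
and return by unit steps. -/
theorem edist_le_of_near {t i d : ℕ} (ht : t ≠ 0) (h : near t i d = true) (x : ℤ) :
    (distanceGraph {1, t}).edist x (x + d) ≤ i := by
  have h1 := edist_add_mul_le (D := {1, t}) (m := 1) (by simp) one_ne_zero
  have h2 := edist_add_mul_le (D := {1, t}) (m := t) (by simp) ht
  have hd : (d : ℤ) = (d / t : ℕ) * (t : ℤ) + (d % t : ℕ) := by
    exact_mod_cast (Nat.div_add_mod' d t).symm
  simp only [near, Bool.or_eq_true, Nat.ble_eq] at h
  rcases h with h | h
  · calc _ ≤ (distanceGraph {1, t}).edist x (x + (d / t : ℕ) * (t : ℤ)) +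
          (distanceGraph {1, t}).edist (x + (d / t : ℕ) * (t : ℤ)) (x + d) :=
          SimpleGraph.edist_triangle
      _ ≤ (d / t : ℕ) + (d % t : ℕ) := by
          refine add_le_add (h2 _ _) ?_
          have hx : x + d = x + (d / t : ℕ) * (t : ℤ) + (d % t : ℕ) * (1 : ℕ) := by
            rw [Nat.cast_one]
            linarith
          rw [hx]
          exact h1 _ _
      _ ≤ i := by exact_mod_cast h
  · calc _ ≤ (distanceGraph {1, t}).edist x (x + (d / t + 1 : ℕ) * (t : ℤ)) +
          (distanceGraph {1, t}).edist (x + (d / t + 1 : ℕ) * (t : ℤ)) (x + d) :=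
          SimpleGraph.edist_triangle
      _ ≤ (d / t + 1 : ℕ) + (t - d % t : ℕ) := by
          refine add_le_add (h2 _ _) ?_
          rw [SimpleGraph.edist_comm]
          have hx : x + (d / t + 1 : ℕ) * (t : ℤ) = x + d + (t - d % t : ℕ) * (1 : ℕ) := by
            rw [Nat.cast_sub (Nat.mod_lt d (Nat.pos_of_ne_zero ht)).le, Nat.cast_one,
              Nat.cast_succ]
            linarith
          rw [hx]
          exact h1 _ _
      _ ≤ i := by exact_mod_cast h

/-- The word `w` lists the values of `h` at `s - 1, s - 2, …`. -/
def Precedes (h : ℤ → ℕ) : ℤ → List ℕ → Prop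
  | _, [] => True
  | s, a :: w => h (s - 1) = a ∧ Precedes h (s - 1) w

/-- Equal nonzero values `k` of `h` never occur at a difference `d > 0` with `near t k d`. -/
def Spread (t : ℕ) (h : ℤ → ℕ) : Prop :=
  ∀ (x : ℤ) (d : ℕ), 0 < d → h x ≠ 0 → h (x - d) = h x → near t (h x) d = false

theorem Spread.admissible {t : ℕ} {h : ℤ → ℕ} (hh : Spread t h) {x : ℤ} (hx : h x ≠ 0)
    (w : List ℕ) (d : ℕ) (hw : Precedes h (x - d) w) :
    admissible t (h x) (d + 1) w = true := by
  induction w generalizing d with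
  | nil => rfl
  | cons a w ih =>
    have hd : x - d - 1 = x - (d + 1 : ℕ) := by push_cast; ring
    obtain ⟨ha, hw⟩ := hw
    rw [hd] at ha hw
    simp only [PackingColoring.admissible, Bool.and_eq_true, ih (d + 1) hw, and_true]
    by_cases hax : a = h x
    · simp [hh x (d + 1) d.succ_pos hx (ha.trans hax)]
    · have : Nat.beq a (h x) = false := by
        rw [← Bool.not_eq_true, Nat.beq_eq]
        exact hax
      simp [this]

/-- The number of nonzero values of `h` on the integer interval `[s, s + l)`. -/
def count (h : ℤ → ℕ) (s : ℤ) (l : ℕ) : ℕ := ∑ j ∈ range l, if h (s + j) = 0 then 0 else 1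

theorem count_add (h : ℤ → ℕ) (s : ℤ) (l m : ℕ) :
    count h s (l + m) = count h s l + count h (s + l) m := by
  simp only [count, sum_range_add, Nat.cast_add, add_assoc]

theorem count_one (h : ℤ → ℕ) (s : ℤ) : count h s 1 = if h s = 0 then 0 else 1 := by
  simp [count]

theorem count_le (h : ℤ → ℕ) (s : ℤ) (l : ℕ) : count h s l ≤ l := by
  calc count h s l ≤ ∑ _j ∈ range l, 1 := sum_le_sum fun j _ => by split_ifs <;> simp
    _ = l := by simp

/-- The actual values of `h` trace one branch of the search tree, and success of the search stops
that branch at a sparse prefix. -/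
theorem exists_window_of_check {t : ℕ} {K : List ℕ} {p q : ℕ} {h : ℤ → ℕ} (hh : Spread t h)
    (hK : ∀ x, h x = 0 ∨ h x ∈ K) (fuel len cnt : ℕ) (w : List ℕ) (s : ℤ)
    (hw : Precedes h s w) (hc : check t K p q fuel len cnt w = true) :
    ∃ l, 0 < l ∧ l ≤ fuel ∧ q * (cnt + count h s l) ≤ p * (len + l) := by
  induction fuel generalizing len cnt w s with
  | zero => simp [check] at hc
  | succ fuel ih =>
    have key : (Nat.ble (q * (cnt + count h s 1)) (p * (len + 1)) ||
        check t K p q fuel (len + 1) (cnt + count h s 1) (h s :: w)) = true := by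
      simp only [check, Bool.and_eq_true, List.all_eq_true] at hc
      rw [count_one]
      by_cases hs : h s = 0
      · simpa [hs] using hc.1
      · have hadm := hh.admissible hs w 0 (by simpa using hw)
        have := hc.2 (h s) ((hK s).resolve_left hs)
        rw [zero_add] at hadm
        simpa [hs, hadm] using this
    rw [Bool.or_eq_true, Nat.ble_eq] at key
    rcases key with key | key
    · exact ⟨1, one_pos, by omega, key⟩
    · have hw' : Precedes h (s + 1) (h s :: w) := by
        rw [Precedes, add_sub_cancel_right]
        exact ⟨rfl, hw⟩
      obtain ⟨l, hl0, hl, hle⟩ := ih (len + 1) _ _ (s + 1) hw' key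
      refine ⟨1 + l, by omega, by omega, ?_⟩
      rw [count_add, ← add_assoc, ← add_assoc]
      exact_mod_cast hle

/-- If from every start some window of length at most `L` has density at most `p / q`, then all
windows have density at most `p / q` up to a bounded error. -/
theorem mul_count_le {h : ℤ → ℕ} {p q L : ℕ}
    (hwin : ∀ s, ∃ l, 0 < l ∧ l ≤ L ∧ q * count h s l ≤ p * l) (N : ℕ) (s : ℤ) :
    q * count h s N ≤ p * N + q * L := by
  induction N using Nat.strong_induction_on generalizing s with
  | _ N ih =>
    obtain ⟨l, hl0, hlL, hl⟩ := hwin s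
    -- Windows are split off greedily; only the last, incomplete one costs an error, and it is
    -- shorter than `L`.
    by_cases hN : l ≤ N
    · obtain ⟨m, rfl⟩ := Nat.exists_eq_add_of_le hN
      have := ih m (by omega) (s + l)
      rw [count_add]
      linarith
    · have : count h s N ≤ L := (count_le h s N).trans (by omega)
      have := Nat.mul_le_mul_left q this
      omega

/-- The density bound for the graph `distanceGraph {1, t}`: if the colors `1, …, k` are covered by
groups `(K, p, q)` such that the union of the color classes in `K` has density at most `p / q`, and
these densities sum to less than `1`, then there is no packing `k`-coloring. -/
theorem not_packingColorable_of_check {t k L : ℕ} (ht : t ≠ 0) (gs : List (List ℕ × ℕ × ℕ))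
    (hcover : ∀ i ∈ Icc 1 k, ∃ g ∈ gs, i ∈ g.1)
    (hq : ∀ g ∈ gs, g.2.2 ≠ 0)
    (hcheck : ∀ g ∈ gs, check t g.1 g.2.1 g.2.2 L 0 0 [] = true)
    (hsum : (gs.map fun g => (g.2.1 / g.2.2 : ℚ)).sum < 1) :
    ¬ PackingColorable (distanceGraph {1, t}) k := by
  rintro ⟨c, hck, hc⟩
  -- Colors outside the group become blanks, which are unconstrained in the search.
  let h : List ℕ → ℤ → ℕ := fun K x => if c x ∈ K then c x else 0
  have hspread : ∀ K, Spread t (h K) := by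
    intro K x d hd hx heq
    have hxK : c x ∈ K := by
      by_contra hn
      exact hx (if_neg hn)
    have hhx : h K x = c x := if_pos hxK
    have hcd : c (x - d) = c x := by
      by_cases hdK : c (x - d) ∈ K
      · rw [← hhx, ← heq]
        exact (if_pos hdK).symm
      · exact absurd ((heq.symm.trans (if_neg hdK))) hx
    rw [hhx]
    by_contra hn
    have hle := edist_le_of_near ht (Bool.eq_true_of_not_eq_false hn) (x - d)
    rw [sub_add_cancel] at hle
    exact absurd (hc (c x) (hck x) (x - d) hcd x rfl (by omega)) (not_lt.2 hle)
  have hbound : ∀ g ∈ gs, ∀ N : ℕ,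
      (count (h g.1) 0 N : ℚ) ≤ (g.2.1 / g.2.2 : ℚ) * N + L := by
    intro g hg N
    have hwin : ∀ s, ∃ l, 0 < l ∧ l ≤ L ∧ g.2.2 * count (h g.1) s l ≤ g.2.1 * l := by
      intro s
      simpa using exists_window_of_check (hspread g.1)
        (fun x => by by_cases hx : c x ∈ g.1 <;> simp [h, hx]) L 0 0 [] s trivial (hcheck g hg)
    have hle := mul_count_le hwin N 0
    have hq0 : (0 : ℚ) < g.2.2 := by exact_mod_cast Nat.pos_of_ne_zero (hq g hg)
    have hle' : (g.2.2 : ℚ) * count (h g.1) 0 N ≤ g.2.1 * N + g.2.2 * L := by exact_mod_cast hle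
    rw [← mul_le_mul_iff_right₀ hq0]
    calc _ ≤ _ := hle'
      _ = _ := by field_simp
  have hpoint : ∀ x, 1 ≤ (gs.map fun g => if h g.1 x = 0 then 0 else 1).sum := by
    intro x
    obtain ⟨g, hg, hx⟩ := hcover (c x) (hck x)
    have hne : c x ≠ 0 := by have := (mem_Icc.1 (hck x)).1; omega
    refine le_trans ?_ (List.le_sum_of_mem (List.mem_map_of_mem hg))
    simp [h, hx, hne]
  have hcount : ∀ N : ℕ, N ≤ (gs.map fun g => count (h g.1) 0 N).sum := by
    intro N
    calc N = ∑ _j ∈ range N, 1 := by simp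
      _ ≤ ∑ j ∈ range N, (gs.map fun g => if h g.1 (0 + j) = 0 then 0 else 1).sum :=
          sum_le_sum fun j _ => hpoint _
      _ = _ := by
          clear hcover hq hcheck hsum hbound hpoint
          induction gs with
          | nil => simp
          | cons g gs ih => simp only [List.map_cons, List.sum_cons, sum_add_distrib, ih, count]
  have htotal : ∀ N : ℕ,
      (N : ℚ) ≤ (gs.map fun g => (g.2.1 / g.2.2 : ℚ)).sum * N + gs.length * L := by
    intro N
    refine le_trans (Nat.cast_le.2 (hcount N)) ?_
    clear hcover hq hcheck hsum hpoint hcount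
    induction gs with
    | nil => simp
    | cons g gs ih =>
      have h1 := hbound g List.mem_cons_self N
      have h2 := ih fun g' hg' => hbound g' (List.mem_cons_of_mem _ hg')
      simp only [List.map_cons, List.sum_cons, List.length_cons, Nat.cast_add, Nat.cast_one]
      linarith
  set σ := (gs.map fun g => (g.2.1 / g.2.2 : ℚ)).sum
  -- The bounded error cannot make up a linear deficit `(1 - σ) * N`.
  obtain ⟨N, hN⟩ := exists_nat_gt ((gs.length * L : ℚ) / (1 - σ))
  rw [div_lt_iff₀ (by linarith)] at hN
  linarith [htotal N]

theorem le_packingChromaticNumber {V : Type*} {G : SimpleGraph V} {n : ℕ}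
    (h : ∀ k < n, ¬ PackingColorable G k) : (n : ℕ∞) ≤ packingChromaticNumber G := by
  refine le_iInf₂ fun k hk => ?_
  by_contra hlt
  exact h k (by exact_mod_cast not_le.1 hlt) hk

/-- Density bounds for the color classes in `distanceGraph {1, 6}`. -/
def groupsOneSix : List (List ℕ × ℕ × ℕ) :=
  [([1, 2], 7, 12), ([3], 2, 19), ([4], 1, 15), ([5], 1, 21), ([6], 1, 27), ([7], 1, 33),
    ([8], 1, 39), ([9], 1, 45), ([10], 1, 51), ([11], 1, 57), ([12], 1, 63), ([13], 1, 69),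
    ([14], 1, 75)]

/-- Density bounds for the color classes in `distanceGraph {1, 8}`. -/
def groupsOneEight : List (List ℕ × ℕ × ℕ) :=
  [([1, 2], 10, 17), ([3], 2, 18), ([4], 2, 26), ([5], 1, 20), ([6], 1, 28), ([7], 1, 36),
    ([8], 1, 44), ([9], 1, 52), ([10], 1, 60), ([11], 1, 68), ([12], 1, 76), ([13], 1, 84),
    ([14], 1, 92)]

/-- The fuel is the largest denominator: a window opening with color 14 reaches density 1/75 only at
length 75. -/
theorem check_groupsOneSix :
    ∀ g ∈ groupsOneSix, check 6 g.1 g.2.1 g.2.2 75 0 0 [] = true := by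
  decide +kernel

theorem check_groupsOneEight :
    ∀ g ∈ groupsOneEight, check 8 g.1 g.2.1 g.2.2 92 0 0 [] = true := by
  decide +kernel

theorem fifteen_le_of_groups {t L : ℕ} (ht : t ≠ 0) (gs : List (List ℕ × ℕ × ℕ))
    (hcover : ∀ i ∈ Icc 1 14, ∃ g ∈ gs, i ∈ g.1) (hq : ∀ g ∈ gs, g.2.2 ≠ 0)
    (hcheck : ∀ g ∈ gs, check t g.1 g.2.1 g.2.2 L 0 0 [] = true)
    (hsum : (gs.map fun g => (g.2.1 / g.2.2 : ℚ)).sum < 1) :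
    15 ≤ packingChromaticNumber (distanceGraph {1, t}) :=
  le_packingChromaticNumber (n := 15) fun _ hk => not_packingColorable_of_check ht gs
    (fun i hi => hcover i (Icc_subset_Icc_right (by omega) hi)) hq hcheck hsum

end PackingColoring

theorem mainTheorem3 :
    15 ≤ PackingColoring.packingChromaticNumber (PackingColoring.distanceGraph {1, 6}) ∧
      15 ≤ PackingColoring.packingChromaticNumber (PackingColoring.distanceGraph {1, 8}) := by
  refine ⟨PackingColoring.fifteen_le_of_groups (by norm_num) PackingColoring.groupsOneSix
      (by decide) (by decide) PackingColoring.check_groupsOneSix ?_,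
    PackingColoring.fifteen_le_of_groups (by norm_num) PackingColoring.groupsOneEight
      (by decide) (by decide) PackingColoring.check_groupsOneEight ?_⟩
  · norm_num [PackingColoring.groupsOneSix]
  · norm_num [PackingColoring.groupsOneEight]
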